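/- Let $R$ be a nontrivial commutative Noetherian ring. For an ideal $\mathfrak a$ of $R$ let $H^i_{\mathfrak a}(-)$ be the $i$-th right derived functor of $\Gamma_{\mathfrak a}(M)=\bigcup_{n\ge 0}(0:_M\mathfrak a^n)$. An $R$-module $X$ is called $\mathfrak a$-cofinite if $\operatorname{Supp}X\subseteq V(\mathfrak a)$ and $\operatorname{Ext}^j_R(R/\mathfrak a,X)$ is a finitely generated $R$-module for all $j\ge 0$. For proper ideals $\mathfrak a,\mathfrak b$ of $R$ and an ideal $I\subseteq\mathfrak a\cap\mathfrak b$ generated by an $R$-regular sequence (possibly empty), write $\mathfrak a\sim_{(I;R)}\mathfrak b$ if $\mathfrak b=I:_R\mathfrak a$ and $\mathfrak a=I:_R\mathfrak b$; say that $\mathfrak a$ is linked by $I$ if $\mathfrak a\sim_{(I;R)}\mathfrak b$ for some ideal $\mathfrak b$. Write $\operatorname{grade}I$ for the supremum of the lengths of $R$-regular sequences contained in $I$. Let $i\ge 0$ be an integer, let $I$ be a non-prime ideal of $R$, and let $\mathfrak a$ be an ideal of $R$ that is linked by $I$. 1. If $H^i_{\mathfrak a}(R)$ is $I$-cofinite,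 then $H^i_{\mathfrak a}(R)$ is $\mathfrak a$-cofinite. 2. If $i>\operatorname{grade}I$ and $\mathfrak b$ is an ideal of $R$ with $\mathfrak a\sim_{(I;R)}\mathfrak b$, then $H^i_{\mathfrak a}(R)$ is both $\mathfrak a$-cofinite and $\mathfrak b$-cofinite if and only if it is $I$-cofinite. -/

import Mathlib

open CategoryTheory

universe u

/-- The `𝔞`-torsion functor `Γ_𝔞` on `R`-modules, `Γ_𝔞(M) = ⋃ₙ (0 :_M 𝔞ⁿ)`; the submodule
`⋃ₙ (0 :_M 𝔞ⁿ)` of `M` is Mathlib's `Ideal.primaryComponent`. -/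
def torsionFunctor {R : Type u} [CommRing R] (a : Ideal R) :
    ModuleCat.{u} R ⥤ ModuleCat.{u} R where
  obj M := ModuleCat.of R (Ideal.primaryComponent M a)
  map f := ModuleCat.ofHom (Ideal.primaryComponent.map a f.hom)

instance {R : Type u} [CommRing R] (a : Ideal R) : (torsionFunctor a).Additive where

/-- The `i`-th local cohomology module `H^i_𝔞(M)`: the value at `M` of the `i`-th right derived
functor of the `𝔞`-torsion functor. -/
noncomputable def localCohomologyModule {R : Type u} [CommRing R] (a : Ideal R) (i : ℕ)
    (M : ModuleCat.{u} R) : ModuleCat.{u} R :=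
  ((torsionFunctor a).rightDerived i).obj M

/-- An `R`-module `X` is `𝔞`-cofinite if `Supp X ⊆ V(𝔞)` and `Ext^j_R(R/𝔞, X)` is a finitely
generated `R`-module for all `j ≥ 0`. -/
structure IsCofinite {R : Type u} [CommRing R] (a : Ideal R) (X : ModuleCat.{u} R) : Prop where
  support_subset : Module.support R X ⊆ PrimeSpectrum.zeroLocus (a : Set R)
  finite_ext : ∀ j : ℕ, Module.Finite R (Abelian.Ext (ModuleCat.of R (R ⧸ a)) X j)

/-- The submodule `N :_M 𝔞 = {m ∈ M | 𝔞 m ⊆ N}` of `M`. -/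
def moduleColon {R M : Type*} [CommRing R] [AddCommGroup M] [Module R M]
    (N : Submodule R M) (a : Ideal R) : Submodule R M where
  carrier := {m | ∀ r ∈ a, r • m ∈ N}
  add_mem' hx hy r hr := by rw [smul_add]; exact N.add_mem (hx r hr) (hy r hr)
  zero_mem' r _ := by rw [smul_zero]; exact N.zero_mem
  smul_mem' c x hx r hr := by rw [smul_comm]; exact N.smul_mem c (hx r hr)

/-- The ideals `𝔞` and `𝔟` are linked by `I` over `M`, written `𝔞 ∼_{(I;M)} 𝔟`. -/
structure IsLinked {R : Type*} [CommRing R] (M : Type*) [AddCommGroup M] [Module R M]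
    (I a b : Ideal R) : Prop where
  left_ne_top : (a • ⊤ : Submodule R M) ≠ ⊤
  right_ne_top : (b • ⊤ : Submodule R M) ≠ ⊤
  le_inf : I ≤ a ⊓ b
  exists_regular : ∃ rs : List R, RingTheory.Sequence.IsRegular M rs ∧ I = Ideal.ofList rs
  right_eq : (b • ⊤ : Submodule R M) = moduleColon (I • ⊤) a
  left_eq : (a • ⊤ : Submodule R M) = moduleColon (I • ⊤) b

/-- The grade of an ideal `I` of `R`: the supremum of the lengths of the `R`-regular sequences
consisting of elements of `I`. -/
noncomputable def idealGrade {R : Type*} [CommRing R] (I : Ideal R) : ℕ∞ :=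
  ⨆ (rs : List R) (_ : RingTheory.Sequence.IsRegular R rs ∧ ∀ r ∈ rs, r ∈ I), (rs.length : ℕ∞)

/-!
Write `X = H^i_𝔞(R)`. Both parts rest on linkage only through `𝔟𝔞 ⊆ I ⊆ 𝔞 ∩ 𝔟`.

If all `Ext^j(R/I, X)` are finitely generated, then so are all `Ext^j(N, X)` with `N` a finitely
generated module killed by `I` (`finite_ext_of_le_annihilator`), in particular for `N = R/𝔞` and
`N = R/𝔟`. Conversely `𝔞/I` is killed by `𝔟`, so the sequence `0 → 𝔞/I → R/I → R/𝔞 → 0` gives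
finiteness of `Ext^j(R/I, X)` from that of `Ext^j(R/𝔞, X)` and `Ext^j(R/𝔟, X)`
(`finite_ext_quotient_of_mul_le`).

As `X` is `𝔞`-torsion, its support lies in `V(𝔞) ⊆ V(I)`. What remains is
`Supp X ⊆ V(𝔟)` when `i` exceeds the length `n` of a regular sequence generating `I`; this length
is at most the grade of `I`. An element `s` of `𝔟` satisfies `s𝔞 ⊆ I`, so a power of `s` carries a given `I`-torsion
element into the `𝔞`-torsion. A class in `X` is represented by an `𝔞`-torsion cocycle `z` of an
injective resolution; `z` is `I`-torsion, hence bounds an `I`-torsion element `y` because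
`H^i_I(R) = 0` for `i > n`, and then `sᵏz` bounds the `𝔞`-torsion element `sᵏy` for some `k`, so
that `sᵏ` kills the class (`support_localCohomologyModule_subset_of_mul_le`).

The vanishing (`exists_d_eq_of_length_lt`) is proved on cocycles, by induction on the number of
generators; the step from `J` to `J + (x)` needs that `Γ_J(E)` is `x`-divisible up to `x`-power
torsion for `E` injective, which is a consequence of the Artin-Rees lemma
(`exists_smul_sub_torsion`).
-/

open Abelian

/-! ### Cofiniteness and change of ideal -/

/-- In a short exact sequence `0 → N₁ → N₂ → N₃ → 0`, finiteness of `Ext^j(N₁, X)` and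
`Ext^j(N₃, X)` gives finiteness of `Ext^j(N₂, X)`. -/
theorem finite_ext_of_exact {R : Type u} [CommRing R] [IsNoetherianRing R]
    {S : ShortComplex (ModuleCat.{u} R)} (hS : S.ShortExact) (X : ModuleCat.{u} R) (j : ℕ)
    (h₁ : Module.Finite R (Ext S.X₁ X j)) (h₃ : Module.Finite R (Ext S.X₃ X j)) :
    Module.Finite R (Ext S.X₂ X j) := by
  let f := (Ext.mk₀ S.f).precompOfLinear R X (zero_add j)
  let g := (Ext.mk₀ S.g).precompOfLinear R X (zero_add j)
  have hfg : Function.Exact g f := by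
    refine LinearMap.exact_iff.2 (le_antisymm ?_ ?_)
    · intro x hx
      obtain ⟨y, hy⟩ := Ext.contravariant_sequence_exact₂ hS X x hx
      exact ⟨y, hy⟩
    · rintro _ ⟨y, rfl⟩
      change (Ext.mk₀ S.f).comp ((Ext.mk₀ S.g).comp y (zero_add j)) (zero_add j) = 0
      simp
  have := isNoetherian_of_range_eq_ker g f hfg.linearMap_ker_eq.symm
  infer_instance

/-- In a short exact sequence `0 → N₁ → N₂ → N₃ → 0`, finiteness of `Ext^j(N₁, X)` and
`Ext^(j+1)(N₂, X)` gives finiteness of `Ext^(j+1)(N₃, X)`. -/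
theorem finite_ext_succ_of_exact {R : Type u} [CommRing R] [IsNoetherianRing R]
    {S : ShortComplex (ModuleCat.{u} R)} (hS : S.ShortExact) (X : ModuleCat.{u} R) (j : ℕ)
    (h₁ : Module.Finite R (Ext S.X₁ X j)) (h₂ : Module.Finite R (Ext S.X₂ X (j + 1))) :
    Module.Finite R (Ext S.X₃ X (j + 1)) := by
  let f := hS.extClass.precompOfLinear R X (add_comm 1 j)
  let g := (Ext.mk₀ S.g).precompOfLinear R X (zero_add (j + 1))
  have hfg : Function.Exact f g := by
    refine LinearMap.exact_iff.2 (le_antisymm ?_ ?_)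
    · intro x hx
      obtain ⟨y, hy⟩ := Ext.contravariant_sequence_exact₃ hS X x hx (add_comm 1 j)
      exact ⟨y, hy⟩
    · rintro _ ⟨y, rfl⟩
      change (Ext.mk₀ S.g).comp (hS.extClass.comp y (add_comm 1 j)) (zero_add (j + 1)) = 0
      simp [ShortComplex.ShortExact.comp_extClass_assoc]
  have := isNoetherian_of_range_eq_ker f g hfg.linearMap_ker_eq.symm
  infer_instance

theorem finite_ext_zero_of_epi {R : Type u} [CommRing R] [IsNoetherianRing R]
    {M N : ModuleCat.{u} R} (f : M ⟶ N) [Epi f] (X : ModuleCat.{u} R)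
    (h : Module.Finite R (Ext M X 0)) : Module.Finite R (Ext N X 0) :=
  Module.Finite.of_injective ((Ext.mk₀ f).precompOfLinear R X (zero_add 0))
    (Ext.precomp_mk₀_injective_of_epi X f)

theorem shortExact_moduleCatMk {R : Type u} [CommRing R] {N₁ N₂ N₃ : Type u} [AddCommGroup N₁]
    [AddCommGroup N₂] [AddCommGroup N₃] [Module R N₁] [Module R N₂] [Module R N₃]
    (f : N₁ →ₗ[R] N₂) (g : N₂ →ₗ[R] N₃) (hf : Function.Injective f)
    (hg : Function.Surjective g) (hfg : Function.Exact f g) :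
    (ShortComplex.moduleCatMk f g hfg.linearMap_comp_eq_zero).ShortExact where
  exact := (ShortComplex.ShortExact.moduleCat_exact_iff_function_exact _).2 hfg
  mono_f := (ModuleCat.mono_iff_injective _).2 hf
  epi_g := (ModuleCat.epi_iff_surjective _).2 hg

/-- If all `Ext^j(R/I, X)` are finitely generated, then so are all `Ext^j(N, X)` with `N` a
finitely generated `R`-module killed by `I`. -/
theorem finite_ext_of_le_annihilator {R : Type u} [CommRing R] [IsNoetherianRing R] {I : Ideal R}
    {X : ModuleCat.{u} R}
    (hX : ∀ j : ℕ, Module.Finite R (Ext (ModuleCat.of R (R ⧸ I)) X j)) (j : ℕ)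
    (N : Type u) [AddCommGroup N] [Module R N] [hN : Module.Finite R N]
    (hIN : I ≤ Module.annihilator R N) : Module.Finite R (Ext (ModuleCat.of R N) X j) := by
  induction j using Nat.strong_induction_on generalizing N with
  | h j ih =>
    revert hIN
    induction hN using IsNoetherianRing.induction_on_isQuotientEquivQuotientPrime R with
    | subsingleton N =>
      intro _
      have : Subsingleton (Ext (ModuleCat.of R N) X j) := subsingleton_of_forall_eq 0 fun x => by
        rw [← Ext.mk₀_id_comp x,
          (ModuleCat.isZero_of_subsingleton (ModuleCat.of R N)).eq_of_src (𝟙 _) 0,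
          Ext.mk₀_zero, Ext.zero_comp]
      infer_instance
    | quotient N p e =>
      intro hIN
      rw [e.annihilator_eq, Ideal.annihilator_quotient] at hIN
      -- The surjection `R/I → N` has a kernel that is again killed by `I`: shift the degree.
      let g : (R ⧸ I) →ₗ[R] N := e.symm.toLinearMap ∘ₗ Submodule.factor hIN
      have hg : Function.Surjective g :=
        e.symm.surjective.comp (Submodule.factor_surjective hIN)
      have hS := shortExact_moduleCatMk (LinearMap.ker g).subtype g
        (Submodule.subtype_injective _) hg (LinearMap.exact_subtype_ker_map g)
      cases j with
      | zero =>
        have : Epi (ModuleCat.ofHom g) := hS.epi_g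
        exact finite_ext_zero_of_epi (ModuleCat.ofHom g) X (hX 0)
      | succ j =>
        exact finite_ext_succ_of_exact hS X j (ih j j.lt_succ_self _
          (Ideal.annihilator_quotient.ge.trans
            ((LinearMap.ker g).subtype.annihilator_le_of_injective
              (Submodule.subtype_injective _)))) (hX (j + 1))
    | exact N₁ N₂ N₃ f g hf hg hfg h₁ h₃ =>
      intro hIN
      exact finite_ext_of_exact (shortExact_moduleCatMk f g hf hg hfg) X j
        (h₁ (hIN.trans (f.annihilator_le_of_injective hf)))
        (h₃ (hIN.trans (g.annihilator_le_of_surjective hg)))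

/-- If `𝔟𝔞 ⊆ I ⊆ 𝔞`, then finiteness of `Ext(R/𝔞, X)` and `Ext(R/𝔟, X)` gives finiteness of
`Ext(R/I, X)`, by the exact sequence `0 → 𝔞/I → R/I → R/𝔞 → 0`. -/
theorem finite_ext_quotient_of_mul_le {R : Type u} [CommRing R] [IsNoetherianRing R]
    {I a b : Ideal R} (hIa : I ≤ a) (hba : b * a ≤ I) {X : ModuleCat.{u} R}
    (ha : ∀ j : ℕ, Module.Finite R (Ext (ModuleCat.of R (R ⧸ a)) X j))
    (hb : ∀ j : ℕ, Module.Finite R (Ext (ModuleCat.of R (R ⧸ b)) X j)) (j : ℕ) :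
    Module.Finite R (Ext (ModuleCat.of R (R ⧸ I)) X j) := by
  let g : (R ⧸ I) →ₗ[R] (R ⧸ a) := Submodule.factor hIa
  refine finite_ext_of_exact (shortExact_moduleCatMk (LinearMap.ker g).subtype g
    (Submodule.subtype_injective _) (Submodule.factor_surjective hIa)
    (LinearMap.exact_subtype_ker_map g)) X j
    (finite_ext_of_le_annihilator hb j _ fun s hs => Module.mem_annihilator.2 ?_) (ha j)
  rintro ⟨x, hx⟩
  obtain ⟨r, rfl⟩ := Submodule.Quotient.mk_surjective I x
  have hr : r ∈ a := (Submodule.Quotient.mk_eq_zero a).1 hx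
  exact Subtype.ext ((Submodule.Quotient.mk_eq_zero I).2 (hba (Ideal.mul_mem_mul hs hr)))

/-! ### Torsion in injective modules -/

theorem mem_primaryComponent_iff {R M : Type*} [CommRing R] [AddCommGroup M] [Module R M]
    {a : Ideal R} {x : M} :
    x ∈ Ideal.primaryComponent M a ↔ ∃ n : ℕ, ∀ r ∈ a ^ n, r • x = 0 := by
  simp [Ideal.primaryComponent_mem]

theorem primaryComponent_anti {R M : Type*} [CommRing R] [AddCommGroup M] [Module R M]
    {a b : Ideal R} (h : a ≤ b) : Ideal.primaryComponent M b ≤ Ideal.primaryComponent M a := by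
  intro x hx
  obtain ⟨n, hn⟩ := mem_primaryComponent_iff.1 hx
  exact mem_primaryComponent_iff.2 ⟨n, fun r hr => hn r (Ideal.pow_right_mono h n hr)⟩

theorem map_mem_primaryComponent {R M N : Type*} [CommRing R] [AddCommGroup M] [Module R M]
    [AddCommGroup N] [Module R N] {a : Ideal R} (f : M →ₗ[R] N) {x : M}
    (hx : x ∈ Ideal.primaryComponent M a) : f x ∈ Ideal.primaryComponent N a :=
  Ideal.primaryComponent_map_mem a f ⟨x, hx⟩

theorem mem_primaryComponent_span_singleton_sup {R M : Type*} [CommRing R] [AddCommGroup M]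
    [Module R M] {a : Ideal R} {r : R} {x : M} :
    x ∈ Ideal.primaryComponent M (Ideal.span {r} ⊔ a) ↔
      (∃ n : ℕ, r ^ n • x = 0) ∧ x ∈ Ideal.primaryComponent M a := by
  constructor
  · intro hx
    refine ⟨?_, primaryComponent_anti le_sup_right hx⟩
    obtain ⟨n, hn⟩ := mem_primaryComponent_iff.1 (primaryComponent_anti le_sup_left hx)
    exact ⟨n, hn _ (Ideal.pow_mem_pow (Ideal.mem_span_singleton_self r) n)⟩
  · rintro ⟨⟨m, hm⟩, hx⟩
    obtain ⟨n, hn⟩ := mem_primaryComponent_iff.1 hx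
    refine mem_primaryComponent_iff.2 ⟨m + n, fun s hs => ?_⟩
    have hle : (Ideal.span {r} ⊔ a) ^ (m + n) ≤
        LinearMap.ker (LinearMap.toSpanSingleton R M x) := by
      refine (Ideal.sup_pow_add_le_pow_sup_pow).trans (sup_le ?_ fun s hs => hn s hs)
      rw [Ideal.span_singleton_pow, Ideal.span_singleton_le_iff_mem]
      exact hm
    exact hle hs

theorem exists_comp_eq_of_ker_le {R : Type u} [CommRing R] {E X Y : Type u} [AddCommGroup E]
    [Module R E] [Module.Injective R E] [AddCommGroup X] [Module R X] [AddCommGroup Y] [Module R Y]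
    (f : X →ₗ[R] Y) (g : X →ₗ[R] E) (h : LinearMap.ker f ≤ LinearMap.ker g) :
    ∃ k : Y →ₗ[R] E, ∀ x, k (f x) = g x := by
  obtain ⟨k, hk⟩ := Module.Injective.out (Q := E) ((LinearMap.ker f).liftQ f le_rfl)
    (LinearMap.ker_eq_bot.1 (Submodule.ker_liftQ_eq_bot _ _ _ le_rfl))
    ((LinearMap.ker f).liftQ g h)
  exact ⟨k, fun x => hk (Submodule.Quotient.mk x)⟩

/-- Up to `r`-power torsion, the `J`-torsion of an injective module over a Noetherian ring is
divisible by `r`: equivalently, `Γ_J(E) → Γ_J(E)_r` is surjective. -/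
theorem exists_smul_sub_torsion {R : Type u} [CommRing R] [IsNoetherianRing R] {E : Type u}
    [AddCommGroup E] [Module R E] [Module.Injective R E] (J : Ideal R) (r : R) {e : E}
    (he : e ∈ Ideal.primaryComponent E J) :
    ∃ f ∈ Ideal.primaryComponent E J, ∃ k : ℕ, r ^ k • (r • f - e) = 0 := by
  obtain ⟨m, hm⟩ := mem_primaryComponent_iff.1 he
  -- The annihilators of the powers of `r` become stationary.
  obtain ⟨k, hk⟩ : ∃ k : ℕ, ∀ c : R, r ^ (k + 1) * c = 0 → r ^ k * c = 0 := by
    obtain ⟨k, hk⟩ := monotone_stabilizes_iff_noetherian.2 (inferInstanceAs (IsNoetherian R R))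
      (⟨fun n => LinearMap.ker (LinearMap.mulLeft R (r ^ n)),
        monotone_nat_of_le_succ fun n c hc => by
          simp only [LinearMap.mem_ker, LinearMap.mulLeft_apply] at hc ⊢
          rw [pow_succ', mul_assoc, hc, mul_zero]⟩ : ℕ →o Ideal R)
    exact ⟨k, fun c hc => (hk (k + 1) k.le_succ).ge hc⟩
  obtain ⟨t, ht⟩ := Ideal.exists_pow_inf_eq_pow_smul J (Ideal.span {r ^ (k + 1)} : Ideal R)
  -- By Artin-Rees, multiples of `r ^ (k + 1)` in `J ^ (m + t)` are `r ^ (k + 1)` times elements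
  -- of `J ^ m`, which makes `r ^ (k + 1) c ↦ r ^ k c e` well defined modulo `J ^ (m + t)`.
  have key : ∀ c : R, r ^ (k + 1) * c ∈ J ^ (m + t) → r ^ k * c ∈ J ^ m := by
    intro c hc
    have h1 : r ^ (k + 1) * c ∈ J ^ m * Ideal.span {r ^ (k + 1)} := by
      have h2 : r ^ (k + 1) * c ∈ J ^ (m + t) • (⊤ : Ideal R) ⊓ Ideal.span {r ^ (k + 1)} :=
        ⟨by simpa using hc, Ideal.mul_mem_right _ _ (Ideal.mem_span_singleton_self _)⟩
      rw [ht (m + t) (Nat.le_add_left t m), Nat.add_sub_cancel] at h2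
      exact Submodule.smul_mono le_rfl inf_le_right h2
    obtain ⟨j, hj, hjc⟩ := Ideal.mem_mul_span_singleton.1 h1
    have h3 := hk (c - j) (by rw [mul_sub, ← hjc]; ring)
    rw [mul_sub, sub_eq_zero] at h3
    rw [h3]
    exact Ideal.mul_mem_left _ _ hj
  obtain ⟨φ, hφ⟩ := exists_comp_eq_of_ker_le
    ((J ^ (m + t) : Ideal R).mkQ ∘ₗ LinearMap.mulLeft R (r ^ (k + 1)))
    (LinearMap.toSpanSingleton R E (r ^ k • e)) (fun c hc => by
      have := hm _ (key c ((Submodule.Quotient.mk_eq_zero _).1 hc))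
      rw [LinearMap.mem_ker, LinearMap.toSpanSingleton_apply, smul_smul, mul_comm]
      exact this)
  refine ⟨φ (Submodule.Quotient.mk 1), mem_primaryComponent_iff.2 ⟨m + t, fun s hs => ?_⟩, k, ?_⟩
  · rw [← map_smul, ← Submodule.Quotient.mk_smul, smul_eq_mul, mul_one,
      (Submodule.Quotient.mk_eq_zero _).2 hs, map_zero]
  · have := hφ 1
    rw [LinearMap.toSpanSingleton_apply, one_smul] at this
    rw [smul_sub, smul_smul, ← pow_succ, ← this, ← map_smul, ← Submodule.Quotient.mk_smul]
    simp

/-- If `z` is a `(x₁, …, xₙ)`-torsion cocycle of degree greater than `n` in an injective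
resolution, then it is the coboundary of a `(x₁, …, xₙ)`-torsion element: local cohomology
vanishes above the number of generators. -/
theorem exists_d_eq_of_length_lt {R : Type u} [CommRing R] [IsNoetherianRing R]
    {M : ModuleCat.{u} R} (E : InjectiveResolution M) (xs : List R) (i : ℕ) (hi : xs.length ≤ i)
    (z : E.cocomplex.X (i + 1)) (hz : z ∈ Ideal.primaryComponent _ (Ideal.ofList xs))
    (hdz : E.cocomplex.d (i + 1) (i + 2) z = 0) :
    ∃ y ∈ Ideal.primaryComponent _ (Ideal.ofList xs), E.cocomplex.d i (i + 1) y = z := by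
  induction xs generalizing i with
  | nil =>
    obtain ⟨y, hy⟩ := (ShortComplex.moduleCat_exact_iff _).1 (E.exact_succ i) z hdz
    refine ⟨y, mem_primaryComponent_iff.2 ⟨1, fun r hr => ?_⟩, hy⟩
    rw [pow_one, Ideal.ofList_nil, Ideal.mem_bot] at hr
    rw [hr, zero_smul]
  | cons x xs ih =>
    obtain ⟨i, rfl⟩ : ∃ l, i = l + 1 := ⟨i - 1, by simp at hi; omega⟩
    have hi' : xs.length ≤ i := by simpa using hi
    rw [Ideal.ofList_cons] at hz ⊢
    obtain ⟨⟨k, hk⟩, hz⟩ := mem_primaryComponent_span_singleton_sup.1 hz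
    obtain ⟨y, hy, rfl⟩ := ih (i + 1) (by omega) z hz hdz
    obtain ⟨w, hw, hwy⟩ := ih i hi' (x ^ k • y) (Submodule.smul_mem _ _ hy) (by
      rw [map_smul, hk])
    have : Module.Injective R (E.cocomplex.X i) :=
      Module.injective_module_of_injective_object (inj := E.injective i)
    obtain ⟨v, hv, n, hn⟩ := exists_smul_sub_torsion (Ideal.ofList xs) (x ^ k) hw
    -- `w = x ^ k v` up to torsion, so `y - d v` is the required preimage.
    refine ⟨y - E.cocomplex.d i (i + 1) v, mem_primaryComponent_span_singleton_sup.2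
      ⟨⟨k * n + k, ?_⟩, sub_mem hy (map_mem_primaryComponent _ hv)⟩, ?_⟩
    · have := congrArg (E.cocomplex.d i (i + 1)) hn
      rw [map_smul, map_sub, map_smul, map_zero, hwy, ← smul_sub, ← neg_sub, smul_neg, smul_neg,
        neg_eq_zero, smul_smul, ← pow_mul, ← pow_add] at this
      exact this
    · rw [map_sub, sub_eq_self]
      exact ConcreteCategory.congr_hom (E.cocomplex.d_comp_d i (i + 1) (i + 2)) v

/-! ### The support of local cohomology -/

/-- Every class in `H^i_𝔞(M)` is represented by an `𝔞`-torsion cocycle `z` of an injective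
resolution, and is killed by each `s` for which `s z` bounds an `𝔞`-torsion element. -/
theorem exists_cocycle_of_localCohomologyModule {R : Type u} [CommRing R] (a : Ideal R)
    {M : ModuleCat.{u} R} (E : InjectiveResolution M) (i : ℕ) (h : localCohomologyModule a i M) :
    ∃ z ∈ Ideal.primaryComponent (E.cocomplex.X i) a, E.cocomplex.d i (i + 1) z = 0 ∧
      ∀ s : R, ∀ y ∈ Ideal.primaryComponent (E.cocomplex.X ((ComplexShape.up ℕ).prev i)) a,
        E.cocomplex.d _ i y = s • z → s • h = 0 := by
  let K := ((torsionFunctor a).mapHomologicalComplex (ComplexShape.up ℕ)).obj E.cocomplex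
  let e : localCohomologyModule a i M ≅ K.homology i := E.isoRightDerivedObj (torsionFunctor a) i
  obtain ⟨c, hc⟩ := (ModuleCat.epi_iff_surjective (K.homologyπ i)).1 inferInstance (e.hom h)
  have hdc : K.d i (i + 1) (K.iCycles i c) = 0 :=
    ConcreteCategory.congr_hom (K.iCycles_d i (i + 1)) c
  refine ⟨(K.iCycles i c).1, (K.iCycles i c).2, congrArg Subtype.val hdc, fun s y hy hys => ?_⟩
  have h1 : K.toCycles _ i ⟨y, hy⟩ = s • c := by
    apply (ModuleCat.mono_iff_injective (K.iCycles i)).1 inferInstance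
    rw [map_smul]
    refine (ConcreteCategory.congr_hom (K.toCycles_i _ i) _).trans (Subtype.ext ?_)
    exact hys
  have h2 : e.hom (s • h) = 0 := by
    rw [map_smul, ← hc, ← map_smul, ← h1]
    exact ConcreteCategory.congr_hom (K.toCycles_comp_homologyπ _ i) _
  exact (ModuleCat.mono_iff_injective e.hom).1 inferInstance (h2.trans (map_zero _).symm)

theorem support_subset_zeroLocus_of_forall_pow_smul_eq_zero {R M : Type*} [CommRing R]
    [AddCommGroup M] [Module R M] {a : Ideal R} (h : ∀ s ∈ a, ∀ x : M, ∃ n : ℕ, s ^ n • x = 0) :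
    Module.support R M ⊆ PrimeSpectrum.zeroLocus (a : Set R) := by
  intro p hp s hs
  obtain ⟨x, hx⟩ := Module.mem_support_iff_exists_annihilator.1 hp
  obtain ⟨n, hn⟩ := h s hs x
  exact p.2.mem_of_pow_mem n (hx (Submodule.mem_annihilator_span_singleton _ _ |>.2 hn))

theorem support_localCohomologyModule_subset {R : Type u} [CommRing R] (a : Ideal R)
    (M : ModuleCat.{u} R) (i : ℕ) :
    Module.support R (localCohomologyModule a i M) ⊆ PrimeSpectrum.zeroLocus (a : Set R) := by
  refine support_subset_zeroLocus_of_forall_pow_smul_eq_zero fun s hs h => ?_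
  obtain ⟨z, hz, -, H⟩ := exists_cocycle_of_localCohomologyModule a (injectiveResolution M) i h
  obtain ⟨n, hn⟩ := mem_primaryComponent_iff.1 hz
  exact ⟨n, H _ 0 (zero_mem _) (by rw [map_zero, hn _ (Ideal.pow_mem_pow hs n)])⟩

/-- If `𝔟𝔞 ⊆ (x₁, …, xₙ) ⊆ 𝔞`, then `H^i_𝔞(M)` is supported in `V(𝔟)` for `i > n`: outside
`V(𝔟)`, `𝔞`-torsion is `(x₁, …, xₙ)`-torsion, whose derived functors vanish above `n`. -/
theorem support_localCohomologyModule_subset_of_mul_le {R : Type u} [CommRing R]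
    [IsNoetherianRing R] {a b : Ideal R} {xs : List R} (hxs : Ideal.ofList xs ≤ a)
    (hba : b * a ≤ Ideal.ofList xs) (M : ModuleCat.{u} R) {i : ℕ} (hi : xs.length < i) :
    Module.support R (localCohomologyModule a i M) ⊆ PrimeSpectrum.zeroLocus (b : Set R) := by
  refine support_subset_zeroLocus_of_forall_pow_smul_eq_zero fun s hs h => ?_
  obtain ⟨z, hz, hdz, H⟩ := exists_cocycle_of_localCohomologyModule a (injectiveResolution M) i h
  obtain ⟨i, rfl⟩ : ∃ l, i = l + 1 := ⟨i - 1, by omega⟩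
  obtain ⟨y, hy, hyz⟩ := exists_d_eq_of_length_lt (injectiveResolution M) xs i (by omega) z
    (primaryComponent_anti hxs hz) hdz
  obtain ⟨n, hn⟩ := mem_primaryComponent_iff.1 hy
  have hprev : (ComplexShape.up ℕ).prev (i + 1) = i := by simp
  rw [hprev] at H
  refine ⟨n, H _ (s ^ n • y) (mem_primaryComponent_iff.2 ⟨n, fun r hr => ?_⟩) ?_⟩
  · rw [smul_smul]
    refine hn _ (Ideal.pow_right_mono hba n ?_)
    rw [mul_pow, mul_comm r]
    exact Ideal.mul_mem_mul (Ideal.pow_mem_pow hs n) hr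
  · rw [map_smul, hyz]

/-! ### Cofiniteness of linked ideals -/

theorem IsLinked.mul_le {R : Type*} [CommRing R] {I a b : Ideal R} (h : IsLinked R I a b) :
    b * a ≤ I := by
  refine Ideal.mul_le.2 fun s hs r hr => ?_
  have h1 : s ∈ moduleColon (I • ⊤ : Submodule R R) a := by
    rw [← h.right_eq]
    simpa using hs
  have h2 : r • s ∈ (I • ⊤ : Submodule R R) := h1 r hr
  simpa [mul_comm] using h2

theorem mainTheorem3 {R : Type u} [CommRing R] [Nontrivial R] [IsNoetherianRing R]
    (i : ℕ) (I a : Ideal R) (hI : ¬ I.IsPrime) (ha : ∃ b : Ideal R, IsLinked R I a b) :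
    (IsCofinite I (localCohomologyModule a i (ModuleCat.of R R)) →
      IsCofinite a (localCohomologyModule a i (ModuleCat.of R R))) ∧
    (idealGrade I < (i : ℕ∞) → ∀ b : Ideal R, IsLinked R I a b →
      ((IsCofinite a (localCohomologyModule a i (ModuleCat.of R R)) ∧
          IsCofinite b (localCohomologyModule a i (ModuleCat.of R R))) ↔
        IsCofinite I (localCohomologyModule a i (ModuleCat.of R R)))) := by
  have key : ∀ c : Ideal R, I ≤ c → IsCofinite I (localCohomologyModule a i (ModuleCat.of R R)) →
      ∀ j : ℕ, Module.Finite R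
        (Ext (ModuleCat.of R (R ⧸ c)) (localCohomologyModule a i (ModuleCat.of R R)) j) :=
    fun c hc h j => finite_ext_of_le_annihilator h.finite_ext j _ (by
      rwa [Ideal.annihilator_quotient])
  have hIa : I ≤ a := ha.elim fun b hb => hb.le_inf.trans inf_le_left
  have hsupp := support_localCohomologyModule_subset a (ModuleCat.of R R) i
  refine ⟨fun h => ⟨hsupp, key a hIa h⟩, fun hi b hb => ⟨fun h => ?_, fun h => ?_⟩⟩
  · exact ⟨hsupp.trans (PrimeSpectrum.zeroLocus_anti_mono hIa),
      finite_ext_quotient_of_mul_le hIa hb.mul_le h.1.finite_ext h.2.finite_ext⟩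
  · obtain ⟨xs, hreg, rfl⟩ := hb.exists_regular
    have hlen : xs.length < i := by
      refine Nat.cast_lt.1 (lt_of_le_of_lt ?_ hi)
      exact le_iSup₂_of_le xs ⟨hreg, fun r hr => Ideal.subset_span hr⟩ le_rfl
    exact ⟨⟨hsupp, key a hIa h⟩,
      support_localCohomologyModule_subset_of_mul_le hIa hb.mul_le _ hlen,
      key b (hb.le_inf.trans inf_le_right) h⟩
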